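/- Let $[n]:=\{1,\dots,n\}$. For integers $k\ge 1$, $s\ge 2$ and $n\ge sk+1$, the $s$-stable Kneser graph $S(n,k,s)$ is the graph whose vertices are all $k$-element subsets $A\subseteq[n]$ in which any two distinct elements have cyclical distance at least $s$ (that is, $s\le j-i\le n-s$ for all $i,j\in A$ with $i<j$), and in which two vertices $A,B$ are joined by an edge if and only if $A\cap B=\emptyset$. For integers $k\ge 1$ and $n\ge 2k+1$, the Schrijver graph $S(n,k)$ is the graph whose vertices are all $k$-element subsets of $[n]$ containing no two cyclically adjacent elements, with edges again between disjoint sets; thus $S(n,k)=S(n,k,2)$. Theorem. For all $k\ge 1$, $s\ge 2$ and $n\ge sk+1$, the graph $S(n,k,s)$ has a Hamilton cycle. In particular, for all $k\ge 1$ and $n\ge 2k+1$, the Schrijver graph $S(n,k)$ has a Hamilton cycle. -/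

import Mathlib

/-- The Kneser graph `K(n,k)`: vertices are the `k`-element subsets of an `n`-element ground set
(here `Fin n`, i.e. `[n]` shifted by one), edges join disjoint sets. The condition `A ≠ B` only
matters for `k = 0`, where the empty set is disjoint from itself. -/
def kneserGraph (n k : ℕ) : SimpleGraph {A : Finset (Fin n) // A.card = k} where
  Adj A B := A ≠ B ∧ Disjoint A.1 B.1
  symm := ⟨fun _ _ h => ⟨h.1.symm, h.2.symm⟩⟩
  loopless := ⟨fun _ h => h.1 rfl⟩

/-- `A` is `s`-stable: any two elements of `A` have cyclical distance at least `s`, i.e. for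
`i < j` in `A` both arcs between them, of lengths `j - i` and `n - (j - i)`, are at least `s`. -/
def IsStableSet {n : ℕ} (s : ℕ) (A : Finset (Fin n)) : Prop :=
  ∀ i ∈ A, ∀ j ∈ A, i < j → i.val + s ≤ j.val ∧ j.val + s ≤ n + i.val

/-- The `s`-stable Kneser graph `S(n,k,s)`: the subgraph of `K(n,k)` induced by the
`s`-stable sets. -/
def stableKneserGraph (n k s : ℕ) :
    SimpleGraph ↥{A : {A : Finset (Fin n) // A.card = k} | IsStableSet s A.1} :=
  (kneserGraph n k).induce {A | IsStableSet s A.1}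

/-- `A` contains no two cyclically adjacent elements: for `i < j` in `A`, we have `j - i ≥ 2`
and `j - i ≠ n - 1`. -/
def NoCyclicallyAdjacent {n : ℕ} (A : Finset (Fin n)) : Prop :=
  ∀ i ∈ A, ∀ j ∈ A, i < j → i.val + 2 ≤ j.val ∧ j.val + 1 ≠ n + i.val

/-- The Schrijver graph `S(n,k)`: the subgraph of `K(n,k)` induced by the sets with no two
cyclically adjacent elements. -/
def schrijverGraph (n k : ℕ) :
    SimpleGraph ↥{A : {A : Finset (Fin n) // A.card = k} | NoCyclicallyAdjacent A.1} :=
  (kneserGraph n k).induce {A | NoCyclicallyAdjacent A.1}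

/-! Rotation `f` by 1 sends every stable set to a disjoint one, and `f (f X) ≠ X`, so its orbits
partition the vertices into cycles. Two cycles are glued at a 4-cycle `X, Y, f Y, f X`: delete `X –
f X` and `Y – f Y`, insert `X – Y` and `f X – f Y`. Here `Y` is `X` with the element 0 moved to 1,
then rotated by 1, which makes it disjoint from `X`. These pairs form a matching, so an edge needed
for a later gluing is never deleted earlier (`IsGluedCycle.union_orbit`), and any family of gluings
connecting the orbits yields a Hamilton cycle (`exists_isHamiltonianCycle_of_perm`).

Connectivity (`IsClosedSet.eq_univ`): up to rotation, a gluing moves one element by one step.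
Pushing elements back towards 0 as far as possible always ends at `{0, s, 2s, …}`, so there is only
one class. -/

namespace SimpleGraph.Walk

/-! ### Paths obtained by opening cycles and by traversing orbits. -/

variable {V : Type*} {G : SimpleGraph V}

theorem IsPath.append_of_disjoint {u v w : V} {p : G.Walk u v} {q : G.Walk v w} (hp : p.IsPath)
    (hq : q.IsPath) (h : ∀ x ∈ p.support, x ∉ q.support.tail) : (p.append q).IsPath := by
  rw [isPath_def, support_append]
  exact List.Nodup.append hp.support_nodup hq.support_nodup.tail fun x hx hx' => h x hx hx'

/-- Rotate the cycle to start at `a`. Since `a` is the tail of only one dart, the given dart comes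
first, and dropping it leaves the path. -/
theorem IsCycle.exists_isPath_of_mem_darts [DecidableEq V] {v a b : V} {c : G.Walk v v}
    (hc : c.IsCycle) (hab : G.Adj a b) (hd : (⟨(a, b), hab⟩ : G.Dart) ∈ c.darts) :
    ∃ p : G.Walk b a, p.IsPath ∧ (∀ w, w ∈ p.support ↔ w ∈ c.support) ∧
      ∀ e, e ∈ c.edges ↔ e = s(a, b) ∨ e ∈ p.edges := by
  have ha : a ∈ c.support := c.dart_fst_mem_support_of_mem_darts hd
  have hc' : (c.rotate a ha).IsCycle := (isCycle_rotate ha).2 hc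
  have hsup : ∀ w, w ∈ (c.rotate a ha).support ↔ w ∈ c.support := fun w => by simp
  have hed : ∀ e, e ∈ (c.rotate a ha).edges ↔ e ∈ c.edges := fun e => (c.rotate_edges a ha).mem_iff
  have hd' : (⟨(a, b), hab⟩ : G.Dart) ∈ (c.rotate a ha).darts := (c.rotate_darts a ha).mem_iff.2 hd
  generalize c.rotate a ha = c' at *
  cases c' with
  | nil => simp at hd'
  | @cons _ x _ h q =>
    have hq := ((cons_isCycle_iff q h).1 hc').1
    rw [darts_cons, List.mem_cons] at hd'
    have hx : x = b := by
      rcases hd' with h1 | h1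
      · simpa using congrArg (fun d : G.Dart => d.snd) h1.symm
      · exfalso
        have h2 : a ∈ q.support.dropLast := by
          rw [← map_fst_darts]; exact List.mem_map.2 ⟨_, h1, rfl⟩
        have h3 := hq.support_nodup
        rw [← List.dropLast_append_getLast q.support_ne_nil, getLast_support] at h3
        exact (List.nodup_append.1 h3).2.2 a h2 a (by simp) rfl
    subst hx
    refine ⟨q, hq, fun w => ?_, fun e => ?_⟩
    · rw [← hsup, support_cons, List.mem_cons]
      exact ⟨Or.inr, fun hw => hw.elim (fun hw => hw ▸ q.end_mem_support) id⟩
    · rw [← hed, edges_cons, List.mem_cons]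

theorem IsCycle.exists_isPath_of_mem_edges [DecidableEq V] {v a b : V} {c : G.Walk v v}
    (hc : c.IsCycle) (he : s(a, b) ∈ c.edges) :
    ∃ p : G.Walk b a, p.IsPath ∧ (∀ w, w ∈ p.support ↔ w ∈ c.support) ∧
      ∀ e, e ∈ c.edges ↔ e = s(a, b) ∨ e ∈ p.edges := by
  have hab : G.Adj a b := c.adj_of_mem_edges he
  obtain ⟨d, hd, hde⟩ := List.mem_map.1 he
  rcases (dart_edge_eq_mk'_iff'.1 hde) with ⟨h1, h2⟩ | ⟨h1, h2⟩
  · exact hc.exists_isPath_of_mem_darts hab (by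
      rwa [show (⟨(a, b), hab⟩ : G.Dart) = d from Dart.ext _ _ (Prod.ext h1.symm h2.symm)])
  · obtain ⟨p, hp, hs, hpe⟩ := hc.reverse.exists_isPath_of_mem_darts hab (by
      rw [darts_reverse, List.mem_reverse, List.mem_map]
      exact ⟨d, hd, Dart.ext _ _ (Prod.ext h2 h1)⟩)
    exact ⟨p, hp, fun w => by simp [hs], fun e => by rw [← hpe]; simp⟩

/-- A path using the edge between its own ends is that single edge. This detects the degenerate case
of an orbit of length two. -/
theorem IsPath.eq_or_eq_of_mem_edges {u v : V} {q : G.Walk u v} (hq : q.IsPath)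
    (h : s(v, u) ∈ q.edges) : ∀ w ∈ q.support, w = u ∨ w = v := by
  cases q with
  | nil => simp at h
  | @cons _ y _ hy r =>
    have hr := (cons_isPath_iff _ _).1 hq
    have hyv : y = v := by
      rw [edges_cons, List.mem_cons] at h
      rcases h with h | h
      · rcases Sym2.eq_iff.1 h with h1 | h1
        · exact absurd (h1.1 ▸ r.end_mem_support) hr.2
        · exact h1.1.symm
      · exact absurd (snd_mem_support_of_mem_edges _ h) hr.2
    subst hyv
    have h1 : r = .nil := (isPath_iff_nil.1 hr.1).eq_nil
    intro w hw
    rw [h1] at hw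
    simpa using hw

/-- The walk `x, f x, f (f x), …` with `n` steps. -/
def iterate {f : V → V} (hf : ∀ x, G.Adj x (f x)) : (n : ℕ) → (x : V) → G.Walk x (f^[n] x)
  | 0, _ => nil
  | n + 1, x => cons (hf x) (iterate hf n (f x))

theorem support_iterate {f : V → V} (hf : ∀ x, G.Adj x (f x)) (n : ℕ) (x : V) :
    (iterate hf n x).support = (List.range (n + 1)).map (f^[·] x) := by
  induction n generalizing x with
  | zero => rfl
  | succ n ih =>
    change x :: (iterate hf n (f x)).support = _
    rw [ih, List.range_succ_eq_map (n := n + 1), List.map_cons, List.map_map]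
    rfl

theorem edges_iterate {f : V → V} (hf : ∀ x, G.Adj x (f x)) (n : ℕ) (x : V) :
    (iterate hf n x).edges = (List.range n).map fun i => s(f^[i] x, f (f^[i] x)) := by
  induction n generalizing x with
  | zero => rfl
  | succ n ih =>
    change s(x, f x) :: (iterate hf n (f x)).edges = _
    rw [ih, List.range_succ_eq_map, List.map_cons, List.map_map]
    rfl

/-- A fixed-point free bijection along edges: each orbit is traversed by a path. -/
theorem exists_isPath_orbit [Finite V] (f : Equiv.Perm V) (hf : ∀ x, G.Adj x (f x)) (b : V) :
    ∃ q : G.Walk (f b) b, q.IsPath ∧ (∀ w, w ∈ q.support ↔ ∃ n : ℕ, f^[n] b = w) ∧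
      ∀ w ∈ q.support, w = b ∨ s(w, f w) ∈ q.edges := by
  set d := Function.minimalPeriod f b with hd
  have hpos : 0 < d :=
    Function.minimalPeriod_pos_of_mem_periodicPts (f.injective.mem_periodicPts b)
  have hit : f^[d] b = b := Function.iterate_minimalPeriod
  have hend : f^[d - 1] (f b) = b := by
    rw [← Function.iterate_succ_apply, Nat.succ_eq_add_one, Nat.sub_add_cancel hpos, hit]
  refine ⟨(iterate hf (d - 1) (f b)).copy rfl hend, ?_, ?_, ?_⟩
  · rw [isPath_copy, isPath_def, support_iterate, Nat.sub_add_cancel hpos]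
    refine List.Nodup.map_on (fun i hi j hj hij => ?_) List.nodup_range
    rw [List.mem_range] at hi hj
    have : f^[i] b = f^[j] b := f.injective (by
      rw [← Function.iterate_succ_apply' f, ← Function.iterate_succ_apply' f]; exact hij)
    exact Function.iterate_injOn_Iio_minimalPeriod hi hj this
  · intro w
    rw [support_copy, support_iterate, Nat.sub_add_cancel hpos, List.mem_map]
    constructor
    · rintro ⟨i, -, rfl⟩
      exact ⟨i + 1, rfl⟩
    · rintro ⟨n, rfl⟩
      -- The index is `n - 1` modulo `d`, because the path starts at `f b` instead of `b`.
      refine ⟨(n + (d - 1)) % d, List.mem_range.2 (Nat.mod_lt _ hpos), ?_⟩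
      have h := Function.iterate_mod_minimalPeriod_eq (f := f) (x := b) (n := n + (d - 1))
      change f^[(n + (d - 1)) % d] (f b) = _
      rw [← Function.iterate_succ_apply, Function.iterate_succ_apply' f, h,
        ← Function.iterate_succ_apply' f, Nat.succ_eq_add_one,
        show n + (d - 1) + 1 = n + d by omega, Function.iterate_add_apply, hit]
  · intro w hw
    rw [support_copy, support_iterate, Nat.sub_add_cancel hpos, List.mem_map] at hw
    obtain ⟨i, hi, rfl⟩ := hw
    rw [List.mem_range] at hi
    by_cases h : i = d - 1
    · left; rw [h]; exact hend
    · right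
      rw [edges_copy, edges_iterate, List.mem_map]
      exact ⟨i, List.mem_range.2 (by omega), rfl⟩

end SimpleGraph.Walk

/-! ### Gluing the orbits of a permutation into one cycle. -/

namespace SimpleGraph

variable {V : Type*} {G : SimpleGraph V}

/-- `U` is closed under `f` and is the vertex set of a cycle of `G` containing all edges
`s(x, f x)` with `x ∈ U`, except possibly those with `x` related by `P` to an element of `U`. -/
def IsGluedCycle (G : SimpleGraph V) (f : V → V) (P : V → V → Prop) (U : Set V) : Prop :=
  (∀ x ∈ U, f x ∈ U) ∧ ∃ v, ∃ c : G.Walk v v, c.IsCycle ∧ (∀ w, w ∈ c.support ↔ w ∈ U) ∧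
    ∀ x ∈ U, (∀ y ∈ U, ¬ P x y) → s(x, f x) ∈ c.edges

theorem mk_apply_injective {f : V → V} (hf2 : ∀ x, f (f x) ≠ x) {x y : V}
    (h : s(x, f x) = s(y, f y)) : x = y := by
  rcases Sym2.eq_iff.1 h with h | ⟨h1, h2⟩
  · exact h.1
  · exact absurd (by rw [← h1, h2]) (hf2 y)

theorem isGluedCycle_orbit [Finite V] (f : Equiv.Perm V) (hf : ∀ x, G.Adj x (f x))
    (hf2 : ∀ x, f (f x) ≠ x) (P : V → V → Prop) (b : V) :
    G.IsGluedCycle f P {w | ∃ n : ℕ, f^[n] b = w} := by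
  obtain ⟨q, hq, hs, he⟩ := Walk.exists_isPath_orbit f hf b
  refine ⟨?_, b, .cons (hf b) q, (Walk.cons_isCycle_iff _ _).2 ⟨hq, fun hb => ?_⟩, fun w => ?_,
    fun x hx _ => ?_⟩
  · rintro _ ⟨n, rfl⟩
    exact ⟨n + 1, Function.iterate_succ_apply' f n b⟩
  · rcases hq.eq_or_eq_of_mem_edges hb _ ((hs (f (f b))).2 ⟨2, rfl⟩) with h | h
    · exact (hf (f b)).ne h.symm
    · exact hf2 b h
  · rw [Walk.support_cons, List.mem_cons, hs]
    exact ⟨fun h => h.elim (fun h => ⟨0, h.symm⟩) id, Or.inr⟩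
  · rw [Walk.edges_cons, List.mem_cons]
    exact (he x ((hs x).2 hx)).imp (fun h => by rw [h]) id

/-- The exchange along `a, b, f b, f a`. It destroys only the edges at `a` and `b`, which are exempt
afterwards because their partners now lie in the union. -/
theorem IsGluedCycle.union_orbit [Finite V] {f : Equiv.Perm V} (hf : ∀ x, G.Adj x (f x))
    (hf2 : ∀ x, f (f x) ≠ x) {P : V → V → Prop} (hsymm : ∀ a b, P a b → P b a)
    (huniq : ∀ a b b', P a b → P a b' → b = b') {a b : V} (hP : P a b)
    (hab : G.Adj a b) (hfab : G.Adj (f a) (f b)) {U : Set V} (hU : G.IsGluedCycle f P U)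
    (ha : a ∈ U) (hb : b ∉ U) :
    G.IsGluedCycle f P (U ∪ {w | ∃ n : ℕ, f^[n] b = w}) := by
  classical
  obtain ⟨hUf, v, c, hc, hcs, hce⟩ := hU
  obtain ⟨q, hq, hqs, hqe⟩ := Walk.exists_isPath_orbit f hf b
  -- The only partner of `a` is `b`, which is outside `U`; so `a – f a` still lies on the cycle and
  -- can be cut.
  obtain ⟨p, hp, hps, hpe⟩ := hc.exists_isPath_of_mem_edges
    (hce a ha fun y hy h => hb (huniq a b y hP h ▸ hy))
  have hdisj : ∀ w ∈ U, w ∉ q.support := by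
    rintro w hw hw'
    obtain ⟨n, rfl⟩ := (hqs w).1 hw'
    have hiter : ∀ m : ℕ, ∀ x ∈ U, f^[m] x ∈ U := by
      intro m
      induction m with
      | zero => exact fun x hx => hx
      | succ m ih => exact fun x hx => ih _ (hUf x hx)
    set d := Function.minimalPeriod f b
    have hpos : 0 < d :=
      Function.minimalPeriod_pos_of_mem_periodicPts (f.injective.mem_periodicPts b)
    have h1 := hiter (n * d - n) _ hw
    rw [← Function.iterate_add_apply, Nat.sub_add_cancel (Nat.le_mul_of_pos_right n hpos)] at h1
    have h2 : Function.IsPeriodicPt f (n * d) b :=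
      (Function.isPeriodicPt_minimalPeriod f b).const_mul n
    rw [h2.eq] at h1
    exact hb h1
  have hpU : ∀ w, w ∈ p.support ↔ w ∈ U := fun w => (hps w).trans (hcs w)
  have hbq : b ∈ q.support := q.end_mem_support
  have hfbq : f b ∈ q.support := q.start_mem_support
  set r : G.Walk (f a) (f b) := p.append (.cons hab q.reverse) with hr
  have hrp : r.IsPath := by
    refine hp.append_of_disjoint ((Walk.cons_isPath_iff _ _).2 ⟨hq.reverse, ?_⟩) ?_
    · rw [Walk.support_reverse, List.mem_reverse]; exact hdisj a ha
    · intro x hx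
      rw [Walk.support_cons, List.tail_cons, Walk.support_reverse, List.mem_reverse]
      exact hdisj x ((hpU x).1 hx)
  have hre : ∀ e, e ∈ r.edges ↔ e ∈ p.edges ∨ e = s(a, b) ∨ e ∈ q.edges := fun e => by
    simp [hr, Walk.edges_append]
  have hrs : ∀ w, w ∈ r.support ↔ w ∈ U ∨ ∃ n : ℕ, f^[n] b = w := fun w => by
    rw [hr, Walk.mem_support_append_iff, Walk.support_cons, List.mem_cons, Walk.support_reverse,
      List.mem_reverse, hpU, hqs]
    constructor
    · rintro (h | rfl | h)
      exacts [Or.inl h, Or.inl ha, Or.inr h]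
    · rintro (h | h)
      exacts [Or.inl h, Or.inr (Or.inr h)]
  refine ⟨?_, f b, .cons hfab.symm r, (Walk.cons_isCycle_iff _ _).2 ⟨hrp, ?_⟩, fun w => ?_, ?_⟩
  · rintro x (hx | ⟨n, rfl⟩)
    · exact Or.inl (hUf x hx)
    · exact Or.inr ⟨n + 1, Function.iterate_succ_apply' f n b⟩
  · rw [hre]
    rintro (h | h | h)
    · exact hdisj _ ((hpU _).1 (p.fst_mem_support_of_mem_edges h)) hfbq
    · rcases Sym2.eq_iff.1 h with h | h
      · exact hdisj a ha (h.1 ▸ hfbq)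
      · exact (hf a).ne h.2.symm
    · exact hdisj _ (hUf a ha) (q.snd_mem_support_of_mem_edges h)
  · rw [Walk.support_cons, List.mem_cons, hrs, Set.mem_union, Set.mem_ofPred_eq]
    exact ⟨fun h => h.elim (fun h => Or.inr ⟨1, h.symm⟩) id, Or.inr⟩
  · intro x hx hxP
    rw [Walk.edges_cons, List.mem_cons, hre]
    rcases hx with hx | hx
    · rcases (hpe _).1 (hce x hx fun y hy => hxP y (Or.inl hy)) with h | h
      · rw [mk_apply_injective hf2 h] at hxP
        exact absurd hP (hxP b (Or.inr ⟨0, rfl⟩))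
      · exact Or.inr (Or.inl h)
    · rcases hqe x ((hqs x).2 hx) with rfl | h
      · exact absurd (hsymm _ _ hP) (hxP a (Or.inl ha))
      · exact Or.inr (Or.inr (Or.inr h))

/-- Let `f` be a permutation moving each vertex to a neighbour, and let `P` be a partial matching of
the vertices such that `a, b, f b, f a` is a 4-cycle whenever `P a b`. If the orbits of `f` are
connected by `P`, then they can be glued to a Hamiltonian cycle. -/
theorem exists_isHamiltonianCycle_of_perm [Finite V] [Nonempty V] [DecidableEq V]
    (f : Equiv.Perm V) (hf : ∀ x, G.Adj x (f x)) (hf2 : ∀ x, f (f x) ≠ x) (P : V → V → Prop)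
    (hsymm : ∀ a b, P a b → P b a) (huniq : ∀ a b b', P a b → P a b' → b = b')
    (hadj : ∀ a b, P a b → G.Adj a b ∧ G.Adj (f a) (f b))
    (hconn : ∀ U : Set V, U.Nonempty → (∀ x ∈ U, f x ∈ U) → (∀ x ∈ U, ∀ y, P x y → y ∈ U) →
      U = Set.univ) :
    ∃ v, ∃ c : G.Walk v v, c.IsHamiltonianCycle := by
  obtain ⟨b⟩ := ‹Nonempty V›
  obtain ⟨U, hU⟩ := (Set.toFinite {U | G.IsGluedCycle f P U}).exists_maximal
    ⟨_, isGluedCycle_orbit f hf hf2 P b⟩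
  have hUG : G.IsGluedCycle f P U := hU.prop
  obtain ⟨hUf, v, c, hc, hcs, -⟩ := id hUG
  have huniv : U = Set.univ := by
    refine hconn U ⟨v, (hcs v).1 c.start_mem_support⟩ hUf fun x hx y hxy => ?_
    by_contra hy
    have hle := hU.le_of_ge (hUG.union_orbit hf hf2 hsymm huniq hxy (hadj x y hxy).1
      (hadj x y hxy).2 hx hy) Set.subset_union_left
    exact hy (hle (Or.inr ⟨0, rfl⟩))
  refine ⟨v, c, Walk.isHamiltonianCycle_iff_isCycle_and_support_count_tail_eq_one.2 ⟨hc, fun w => ?_⟩⟩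
  have hw : w ∈ c.support := (hcs w).2 (huniv ▸ Set.mem_univ w)
  refine List.count_eq_one_of_mem hc.support_nodup ?_
  rcases (Walk.mem_support_iff c).1 hw with rfl | h
  · exact Walk.end_mem_tail_support hc.not_nil
  · exact h

end SimpleGraph

theorem Fin.val_sub_cases {n : ℕ} (x y : Fin n) :
    (y.val ≤ x.val ∧ (x - y).val + y.val = x.val) ∨
      (x.val < y.val ∧ (x - y).val + y.val = x.val + n) := by
  rcases le_or_gt y x with h | h
  · left
    rw [Fin.sub_val_of_le h]
    have : y.val ≤ x.val := h
    omega
  · right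
    rw [Fin.coe_sub_iff_lt.2 h]
    have : x.val < y.val := h
    omega

theorem Fin.val_one_of_two_le {n : ℕ} [NeZero n] (hn : 2 ≤ n) : (1 : Fin n).val = 1 := by
  rw [Fin.val_one', Nat.mod_eq_of_lt hn]

theorem Fin.forall_mem_of_add_one_mem {n : ℕ} [NeZero n] (hn : 2 ≤ n) {S : Set (Fin n)} {a : Fin n}
    (ha : a ∈ S) (hS : ∀ x ∈ S, x + 1 ∈ S) (y : Fin n) : y ∈ S := by
  suffices h : ∀ m : ℕ, ∀ y : Fin n, (y - a).val = m → y ∈ S from h _ y rfl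
  intro m
  induction m with
  | zero =>
    intro y hy
    have h1 : y - a = 0 := Fin.ext hy
    rwa [sub_eq_zero.1 h1]
  | succ m ih =>
    intro y hy
    have h1 : (y - 1 - a).val = m := by
      have h2 := Fin.val_sub_cases (y - a) 1
      rw [Fin.val_one_of_two_le hn] at h2
      rw [sub_right_comm]
      omega
    simpa using hS _ (ih _ h1)

theorem isStableSet_iff {n s : ℕ} {A : Finset (Fin n)} :
    IsStableSet s A ↔ ∀ i ∈ A, ∀ j ∈ A, i ≠ j → s ≤ (j - i).val := by
  constructor
  · intro h i hi j hj hij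
    have h1 := Fin.val_sub_cases j i
    rcases lt_or_gt_of_ne hij with hlt | hlt
    · have := h i hi j hj hlt
      omega
    · have := h j hj i hi hlt
      have := i.isLt
      omega
  · intro h i hi j hj hij
    have h1 := Fin.val_sub_cases j i
    have h2 := Fin.val_sub_cases i j
    have h3 := h i hi j hj hij.ne
    have h4 := h j hj i hi hij.ne'
    have h5 : i.val < j.val := hij
    omega

theorem noCyclicallyAdjacent_iff {n : ℕ} {A : Finset (Fin n)} :
    NoCyclicallyAdjacent A ↔ IsStableSet 2 A := by
  refine forall₅_congr fun i _ j _ hij => ?_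
  have := j.isLt
  omega

/-- The translate `A + c` in the cyclic group `Fin n`. -/
def Finset.rotate {n : ℕ} [NeZero n] (c : Fin n) (A : Finset (Fin n)) : Finset (Fin n) :=
  A.map (Equiv.addRight c).toEmbedding

theorem Finset.mem_rotate {n : ℕ} [NeZero n] {c x : Fin n} {A : Finset (Fin n)} :
    x ∈ A.rotate c ↔ x - c ∈ A := by
  rw [rotate, mem_map_equiv]
  simp [sub_eq_add_neg]

theorem Finset.card_rotate {n : ℕ} [NeZero n] (c : Fin n) (A : Finset (Fin n)) :
    (A.rotate c).card = A.card :=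
  card_map _

theorem Finset.rotate_rotate {n : ℕ} [NeZero n] (c d : Fin n) (A : Finset (Fin n)) :
    (A.rotate c).rotate d = A.rotate (c + d) := by
  ext x
  rw [mem_rotate, mem_rotate, mem_rotate, sub_sub, add_comm d]

theorem Finset.rotate_zero {n : ℕ} [NeZero n] (A : Finset (Fin n)) : A.rotate 0 = A := by
  ext x
  rw [mem_rotate, sub_zero]

theorem IsStableSet.rotate {n s : ℕ} [NeZero n] {A : Finset (Fin n)} (hA : IsStableSet s A)
    (c : Fin n) : IsStableSet s (A.rotate c) := by
  rw [isStableSet_iff] at hA ⊢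
  intro i hi j hj hij
  rw [Finset.mem_rotate] at hi hj
  simpa using hA _ hi _ hj (sub_left_injective.ne hij)

/-- Moving an element `b` of a stable set one step back, provided that the gap before it is
larger than `s`. -/
theorem IsStableSet.insert_sub_one {n s : ℕ} [NeZero n] (hn : 2 ≤ n) {A : Finset (Fin n)}
    (hA : IsStableSet s A) {b : Fin n} (hb : b ∈ A) (hgap : ∀ j ∈ A, (b - j).val ≠ s) :
    IsStableSet s (insert (b - 1) (A.erase b)) := by
  rw [isStableSet_iff] at hA ⊢
  have h1 := Fin.val_one_of_two_le hn
  have hb1 := Fin.val_sub_cases b 1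
  have key : ∀ j ∈ A.erase b, s ≤ (j - (b - 1)).val ∨ j = b - 1 := by
    intro j hj
    rw [Finset.mem_erase] at hj
    have e1 := hA b hb j hj.2 hj.1.symm
    have e2 := hA j hj.2 b hb hj.1
    have e3 := Fin.val_sub_cases j b
    have e4 := Fin.val_sub_cases b j
    have e5 := Fin.val_sub_cases j (b - 1)
    have e6 : j = b - 1 ↔ j.val = (b - 1).val := Fin.ext_iff
    rw [e6]
    omega
  have key' : ∀ j ∈ A.erase b, s ≤ (b - 1 - j).val := by
    intro j hj
    rw [Finset.mem_erase] at hj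
    have e2 := hA j hj.2 b hb hj.1
    have e4 := Fin.val_sub_cases b j
    have e5 := Fin.val_sub_cases (b - 1) j
    have e6 := hgap j hj.2
    have e7 : j.val ≠ b.val := Fin.val_ne_of_ne hj.1
    omega
  intro i hi j hj hij
  rw [Finset.mem_insert] at hi hj
  rcases hi with rfl | hi <;> rcases hj with rfl | hj
  · exact absurd rfl hij
  · exact (key j hj).resolve_right hij.symm
  · exact key' i hi
  · exact hA i (Finset.mem_of_mem_erase hi) j (Finset.mem_of_mem_erase hj) hij

/-- A stable set containing `0` in which no further element can be moved back consists of the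
first multiples of `s`. -/
theorem IsStableSet.image_val_eq {n s : ℕ} [NeZero n] (hs : 2 ≤ s) {B : Finset (Fin n)}
    (hB : IsStableSet s B) (h0 : 0 ∈ B) (h : ∀ b ∈ B, b ≠ 0 → ∃ j ∈ B, (b - j).val = s) :
    B.image Fin.val = (Finset.range B.card).image (s * ·) := by
  have hsinj : Function.Injective (s * ·) := fun a b hab =>
    Nat.eq_of_mul_eq_mul_left (by omega) hab
  have key : ∀ m : ℕ, ∀ b ∈ B, b.val = m →
      ∃ i, m = s * i ∧ ∀ j ≤ i, s * j ∈ B.image Fin.val := by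
    intro m
    induction m using Nat.strong_induction_on with
    | _ m ih =>
      intro b hb hbm
      by_cases hb0 : b = 0
      · subst hb0
        refine ⟨0, by rw [← hbm]; simp, fun j hj => ?_⟩
        obtain rfl : j = 0 := by omega
        exact Finset.mem_image.2 ⟨0, h0, by simp⟩
      · obtain ⟨j, hj, hjs⟩ := h b hb hb0
        have e1 := isStableSet_iff.1 hB 0 h0 b hb (Ne.symm hb0)
        rw [sub_zero] at e1
        have e2 := Fin.val_sub_cases b j
        have e3 := j.isLt
        have e4 : j.val + s = b.val := by omega
        obtain ⟨i, hi, hi'⟩ := ih j.val (by omega) j hj rfl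
        refine ⟨i + 1, by rw [mul_add]; omega, fun t ht => ?_⟩
        rcases Nat.lt_or_ge i t with h' | h'
        · obtain rfl : t = i + 1 := by omega
          exact Finset.mem_image.2 ⟨b, hb, by rw [mul_add]; omega⟩
        · exact hi' t h'
  refine Finset.eq_of_subset_of_card_le (fun x hx => ?_) ?_
  · obtain ⟨b, hb, rfl⟩ := Finset.mem_image.1 hx
    obtain ⟨i, hi, hi'⟩ := key _ b hb rfl
    refine Finset.mem_image.2 ⟨i, Finset.mem_range.2 ?_, hi.symm⟩
    have hsub : (Finset.range (i + 1)).image (s * ·) ⊆ B.image Fin.val := by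
      intro y hy
      obtain ⟨j, hj, rfl⟩ := Finset.mem_image.1 hy
      exact hi' j (by rw [Finset.mem_range] at hj; omega)
    have hc := Finset.card_le_card hsub
    rw [Finset.card_image_of_injective _ hsinj, Finset.card_range,
      Finset.card_image_of_injective _ Fin.val_injective] at hc
    omega
  · rw [Finset.card_image_of_injective _ hsinj, Finset.card_range,
      Finset.card_image_of_injective _ Fin.val_injective]

/-- The vertices of the `s`-stable Kneser graph. -/
abbrev StableVertex (n k s : ℕ) : Type :=
  ↥{A : {A : Finset (Fin n) // A.card = k} | IsStableSet s A.1}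

namespace StableVertex

variable {n k s : ℕ}

theorem ext_finset {X Y : StableVertex n k s} (h : X.1.1 = Y.1.1) : X = Y :=
  Subtype.ext (Subtype.ext h)

theorem stable (X : StableVertex n k s) : ∀ i ∈ X.1.1, ∀ j ∈ X.1.1, i ≠ j → s ≤ (j - i).val :=
  isStableSet_iff.1 X.2

theorem adj_of_disjoint (hk : 1 ≤ k) {X Y : StableVertex n k s} (h : Disjoint X.1.1 Y.1.1) :
    (stableKneserGraph n k s).Adj X Y := by
  refine ⟨fun hXY => ?_, h⟩
  have hXY' : X.1.1 = Y.1.1 := congrArg Subtype.val hXY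
  rw [← hXY', disjoint_self, Finset.bot_eq_empty] at h
  have := X.1.2
  rw [h, Finset.card_empty] at this
  omega

variable [NeZero n]

/-- Rotation by `c` as a permutation of the vertices. -/
def rot (c : Fin n) : Equiv.Perm (StableVertex n k s) where
  toFun X := ⟨⟨X.1.1.rotate c, (Finset.card_rotate c _).trans X.1.2⟩, IsStableSet.rotate X.2 c⟩
  invFun X :=
    ⟨⟨X.1.1.rotate (-c), (Finset.card_rotate (-c) _).trans X.1.2⟩, IsStableSet.rotate X.2 (-c)⟩
  left_inv X := ext_finset (by
    change (X.1.1.rotate c).rotate (-c) = X.1.1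
    rw [Finset.rotate_rotate, add_neg_cancel, Finset.rotate_zero])
  right_inv X := ext_finset (by
    change (X.1.1.rotate (-c)).rotate c = X.1.1
    rw [Finset.rotate_rotate, neg_add_cancel, Finset.rotate_zero])

theorem rot_val (c : Fin n) (X : StableVertex n k s) : (rot c X).1.1 = X.1.1.rotate c := rfl

theorem mem_rot {c x : Fin n} {X : StableVertex n k s} : x ∈ (rot c X).1.1 ↔ x - c ∈ X.1.1 :=
  Finset.mem_rotate

theorem rot_rot (c d : Fin n) (X : StableVertex n k s) : rot d (rot c X) = rot (c + d) X :=
  ext_finset (Finset.rotate_rotate c d X.1.1)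

theorem disjoint_rot_one (hs : 2 ≤ s) (hn : 2 ≤ n) (X : StableVertex n k s) :
    Disjoint X.1.1 (rot 1 X).1.1 := by
  rw [Finset.disjoint_left]
  intro x hx hx'
  rw [mem_rot] at hx'
  have h1 := Fin.val_one_of_two_le hn
  have h2 := X.stable _ hx' x hx (by
    intro h
    have h3 : (1 : Fin n) = 0 := by simpa using h
    rw [h3] at h1
    simp at h1)
  rw [sub_sub_cancel, h1] at h2
  omega

theorem rot_one_rot_one_ne (hk : 1 ≤ k) (hn : 2 * k + 1 ≤ n) (X : StableVertex n k s) :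
    rot 1 (rot 1 X) ≠ X := by
  intro h
  obtain ⟨a, ha⟩ := Finset.card_pos.1 (by rw [X.1.2]; omega : 0 < X.1.1.card)
  have huniv : X.1.1 ∪ (rot 1 X).1.1 = Finset.univ := by
    refine Finset.eq_univ_of_forall fun y => ?_
    refine Fin.forall_mem_of_add_one_mem (by omega)
      (S := {y | y ∈ X.1.1 ∪ (rot 1 X).1.1}) (a := a) (Finset.mem_union_left _ ha) ?_ y
    intro x hx
    rcases Finset.mem_union.1 hx with hx | hx
    · exact Finset.mem_union_right _ (by rwa [mem_rot, add_sub_cancel_right])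
    · refine Finset.mem_union_left _ ?_
      rw [← h, mem_rot, add_sub_cancel_right]
      exact hx
  have hc := Finset.card_union_le X.1.1 (rot 1 X).1.1
  rw [huniv, Finset.card_univ, Fintype.card_fin, X.1.2, (rot 1 X).1.2] at hc
  omega

/-- `Y` arises from `X` by moving the element `0` to `1` and then rotating by `1`. -/
def MoveZero (X Y : StableVertex n k s) : Prop :=
  0 ∈ X.1.1 ∧ Y.1.1 = (insert 1 (X.1.1.erase 0)).rotate 1

theorem MoveZero.one_notMem {X Y : StableVertex n k s} (h : MoveZero X Y) (hs : 2 ≤ s)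
    (hn : 2 ≤ n) : (1 : Fin n) ∉ X.1.1 := by
  intro h1
  have h2 := Fin.val_one_of_two_le hn
  have h3 := X.stable 0 h.1 1 h1 (by
    intro h3
    rw [← h3] at h2
    simp at h2)
  rw [sub_zero, h2] at h3
  omega

theorem MoveZero.mem_iff {X Y : StableVertex n k s} (h : MoveZero X Y) {x : Fin n} :
    x ∈ Y.1.1 ↔ x - 1 = 1 ∨ (x - 1 ≠ 0 ∧ x - 1 ∈ X.1.1) := by
  rw [h.2, Finset.mem_rotate, Finset.mem_insert, Finset.mem_erase]

theorem MoveZero.disjoint {X Y : StableVertex n k s} (h : MoveZero X Y) (hs : 2 ≤ s)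
    (hn : 3 ≤ n) : Disjoint X.1.1 Y.1.1 := by
  have h1 := Fin.val_one_of_two_le (show 2 ≤ n by omega)
  rw [Finset.disjoint_left]
  intro x hx hxY
  rcases h.mem_iff.1 hxY with h2 | ⟨-, h2⟩
  · have hx0 : x + 1 - 1 ≠ 1 := by
      rw [add_sub_cancel_right]
      rintro rfl
      exact h.one_notMem hs (by omega) hx
    have e0 := Fin.val_sub_cases x 1
    have e00 := Fin.val_sub_cases (1 : Fin n) 0
    have hxv : x.val = 2 := by rw [h2] at e0; omega
    have hxne : x ≠ 0 := fun h' => by rw [h'] at hxv; simp at hxv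
    have h4 : x + 1 ∈ Y.1.1 := h.mem_iff.2 (Or.inr (by
      rw [add_sub_cancel_right]; exact ⟨hxne, hx⟩))
    have h5 := Y.stable x hxY (x + 1) h4 (by
      intro h'
      have h6 : (1 : Fin n) = 0 := by simpa using h'
      rw [h6] at h1
      simp at h1)
    rw [add_sub_cancel_left, h1] at h5
    omega
  · exact Finset.disjoint_left.1 (X.disjoint_rot_one hs (by omega)) hx (mem_rot.2 h2)

theorem MoveZero.right_unique {X Y Y' : StableVertex n k s} (h : MoveZero X Y)
    (h' : MoveZero X Y') : Y = Y' :=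
  ext_finset (h.2.trans h'.2.symm)

theorem MoveZero.left_unique {X X' Y : StableVertex n k s} (h : MoveZero X Y)
    (h' : MoveZero X' Y) (hs : 2 ≤ s) (hn : 2 ≤ n) : X = X' := by
  refine ext_finset (Finset.ext fun x => ?_)
  by_cases h0 : x = 0
  · rw [h0]; exact iff_of_true h.1 h'.1
  by_cases h1 : x = 1
  · rw [h1]; exact iff_of_false (h.one_notMem hs hn) (h'.one_notMem hs hn)
  have := (h.mem_iff (x := x + 1)).symm.trans (h'.mem_iff (x := x + 1))
  rw [add_sub_cancel_right] at this
  simpa [h0, h1] using this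

theorem MoveZero.not_moveZero {X Y Z : StableVertex n k s} (h : MoveZero X Y) (hs : 2 ≤ s)
    (hn : 3 ≤ n) : ¬ MoveZero Y Z := by
  intro h'
  have h1 := Fin.val_one_of_two_le (show 2 ≤ n by omega)
  have e := Fin.val_sub_cases (0 : Fin n) 1
  have h0 : (0 : Fin n).val = 0 := Fin.val_zero n
  rcases h.mem_iff.1 h'.1 with h2 | ⟨h3, h2⟩
  · rw [h2] at e
    omega
  · have h4 := X.stable _ h2 0 h.1 h3
    rw [sub_sub_cancel, h1] at h4
    omega

/-- The pairs of vertices at which orbits of the rotation are glued. -/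
def Paired (X Y : StableVertex n k s) : Prop :=
  MoveZero X Y ∨ MoveZero Y X

theorem Paired.unique (hs : 2 ≤ s) (hn : 3 ≤ n) {X Y Y' : StableVertex n k s} (h : Paired X Y)
    (h' : Paired X Y') : Y = Y' := by
  rcases h with h | h <;> rcases h' with h' | h'
  · exact h.right_unique h'
  · exact absurd h (h'.not_moveZero hs hn)
  · exact absurd h' (h.not_moveZero hs hn)
  · exact h.left_unique h' hs (by omega)

theorem Paired.disjoint (hs : 2 ≤ s) (hn : 3 ≤ n) {X Y : StableVertex n k s} (h : Paired X Y) :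
    Disjoint X.1.1 Y.1.1 :=
  h.elim (fun h => h.disjoint hs hn) fun h => (h.disjoint hs hn).symm

theorem disjoint_rot {X Y : StableVertex n k s} (h : Disjoint X.1.1 Y.1.1) (c : Fin n) :
    Disjoint (rot c X).1.1 (rot c Y).1.1 :=
  (Finset.disjoint_map _).2 h

/-- Being closed under rotation and under the pairing. -/
def IsClosedSet (U : Set (StableVertex n k s)) : Prop :=
  (∀ X ∈ U, rot 1 X ∈ U) ∧ ∀ X ∈ U, ∀ Y, Paired X Y → Y ∈ U

theorem IsClosedSet.rot_mem {U : Set (StableVertex n k s)} (hU : IsClosedSet U) (hn : 2 ≤ n)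
    {X : StableVertex n k s} (hX : X ∈ U) (c : Fin n) : rot c X ∈ U := by
  refine Fin.forall_mem_of_add_one_mem hn (S := {c | rot c X ∈ U}) (a := 0) ?_ ?_ c
  · have : rot 0 X = X := ext_finset (Finset.rotate_zero _)
    rwa [Set.mem_ofPred_eq, this]
  · intro c hc
    rw [Set.mem_ofPred_eq, ← rot_rot]
    exact hU.1 _ hc

theorem IsClosedSet.compl {U : Set (StableVertex n k s)} (hU : IsClosedSet U) (hn : 2 ≤ n) :
    IsClosedSet Uᶜ := by
  refine ⟨fun X hX hX' => hX ?_, fun X hX Y hXY hY => hX (hU.2 Y hY X hXY.symm)⟩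
  have := hU.rot_mem hn hX' (-1)
  rw [rot_rot, add_neg_cancel] at this
  rwa [show rot 0 X = X from ext_finset (Finset.rotate_zero _)] at this

theorem IsClosedSet.move_mem {U : Set (StableVertex n k s)} (hU : IsClosedSet U) (hn : 2 ≤ n)
    {X Y : StableVertex n k s} (hX : X ∈ U) {b : Fin n} (hb : b ∈ X.1.1) (hb' : b - 1 ∉ X.1.1)
    (hY : Y.1.1 = insert (b - 1) (X.1.1.erase b)) : Y ∈ U := by
  have h10 : (1 : Fin n) ≠ 0 := fun h => by
    have h1 := Fin.val_one_of_two_le hn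
    rw [h] at h1
    simp at h1
  have hm : MoveZero (rot (-(b - 1)) Y) (rot 1 (rot (-(b - 1)) X)) := by
    refine ⟨?_, ?_⟩
    · rw [mem_rot, hY]
      simp
    · rw [rot_val]
      congr 1
      ext x
      have e : x - -(b - 1) = b ↔ x = 1 := by
        constructor
        · intro h
          have : x = b + -(b - 1) := sub_eq_iff_eq_add.1 h
          rw [this]; abel
        · rintro rfl; abel
      have e' : x - -(b - 1) = b - 1 ↔ x = 0 := by
        rw [sub_neg_eq_add]; simp
      rw [mem_rot, Finset.mem_insert, Finset.mem_erase, mem_rot, hY, Finset.mem_insert,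
        Finset.mem_erase, e', ← e]
      have h1 : x - -(b - 1) = b → x - -(b - 1) ∈ X.1.1 := fun h => h.symm ▸ hb
      have h2 : x = 0 → x - -(b - 1) ∉ X.1.1 := fun h => (e'.2 h).symm ▸ hb'
      tauto
  have h1 := hU.2 _ (hU.1 _ (hU.rot_mem hn hX (-(b - 1)))) _ (Or.inr hm)
  have h2 := hU.rot_mem hn h1 (b - 1)
  rw [rot_rot, neg_add_cancel] at h2
  rwa [show rot 0 Y = Y from ext_finset (Finset.rotate_zero _)] at h2

theorem IsClosedSet.exists_image_val_eq {U : Set (StableVertex n k s)} (hU : IsClosedSet U)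
    (hne : U.Nonempty) (hk : 1 ≤ k) (hs : 2 ≤ s) (hn : 2 ≤ n) :
    ∃ X ∈ U, X.1.1.image Fin.val = (Finset.range k).image (s * ·) := by
  have h1 := Fin.val_one_of_two_le hn
  obtain ⟨A, hA⟩ := hne
  obtain ⟨a, ha⟩ := Finset.card_pos.1 (by rw [A.1.2]; omega : 0 < A.1.1.card)
  obtain ⟨B, ⟨hBU, hB0⟩, hBmin⟩ := Set.exists_min_image {X | X ∈ U ∧ 0 ∈ X.1.1}
    (fun X => ∑ x ∈ X.1.1, x.val) (Set.toFinite _)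
    ⟨rot (-a) A, hU.rot_mem hn hA _, by rw [mem_rot]; simpa using ha⟩
  have hB := IsStableSet.image_val_eq hs B.2 hB0 (by
    intro b hb hb0
    by_contra! hgap
    have hb1 : b - 1 ∉ B.1.1 := by
      intro h
      have h2 := B.stable _ h b hb (by
        intro h'
        have h3 : (1 : Fin n) = 0 := by simpa using h'
        rw [h3] at h1
        simp at h1)
      rw [sub_sub_cancel, h1] at h2
      omega
    have hb1' : b - 1 ∉ B.1.1.erase b := fun h => hb1 (Finset.mem_of_mem_erase h)
    let Y : StableVertex n k s := ⟨⟨insert (b - 1) (B.1.1.erase b), by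
      rw [Finset.card_insert_of_notMem hb1', Finset.card_erase_add_one hb, B.1.2]⟩,
      IsStableSet.insert_sub_one hn B.2 hb hgap⟩
    have hY : Y ∈ U := hU.move_mem hn hBU hb hb1 rfl
    have hmin := hBmin Y ⟨hY, Finset.mem_insert_of_mem (Finset.mem_erase.2 ⟨hb0.symm, hB0⟩)⟩
    change ∑ x ∈ B.1.1, x.val ≤ ∑ x ∈ insert (b - 1) (B.1.1.erase b), x.val at hmin
    rw [Finset.sum_insert hb1', ← Finset.add_sum_erase _ _ hb] at hmin
    have e := Fin.val_sub_cases b 1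
    have e0 : b.val ≠ 0 := Fin.val_ne_of_ne hb0
    omega)
  rw [B.1.2] at hB
  exact ⟨B, hBU, hB⟩

theorem IsClosedSet.eq_univ {U : Set (StableVertex n k s)} (hU : IsClosedSet U)
    (hne : U.Nonempty) (hk : 1 ≤ k) (hs : 2 ≤ s) (hn : 2 ≤ n) : U = Set.univ := by
  by_contra h
  obtain ⟨X, hX, hX'⟩ := hU.exists_image_val_eq hne hk hs hn
  obtain ⟨Y, hY, hY'⟩ := (hU.compl hn).exists_image_val_eq (Set.nonempty_compl.2 h) hk hs hn
  have : X = Y := ext_finset (Finset.image_injective Fin.val_injective (hX'.trans hY'.symm))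
  exact hY (this ▸ hX)

end StableVertex

theorem nonempty_stableVertex {n k s : ℕ} (hs : 1 ≤ s) (hn : s * k ≤ n) :
    Nonempty (StableVertex n k s) := by
  have hlt : ∀ i : Fin k, s * i.val < n := fun i =>
    lt_of_lt_of_le (Nat.mul_lt_mul_of_pos_left i.isLt hs) hn
  let e : Fin k ↪ Fin n := ⟨fun i => ⟨s * i.val, hlt i⟩, fun i j hij =>
    Fin.ext (Nat.eq_of_mul_eq_mul_left hs (congrArg Fin.val hij))⟩
  refine ⟨⟨⟨Finset.univ.map e, by simp⟩, ?_⟩⟩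
  intro x hx y hy hxy
  obtain ⟨i, -, rfl⟩ := Finset.mem_map.1 hx
  obtain ⟨j, -, rfl⟩ := Finset.mem_map.1 hy
  change s * i.val < s * j.val at hxy
  change s * i.val + s ≤ s * j.val ∧ s * j.val + s ≤ n + s * i.val
  have h1 : s * (i.val + 1) ≤ s * j.val := Nat.mul_le_mul_left s (Nat.lt_of_mul_lt_mul_left hxy)
  have h2 : s * (j.val + 1) ≤ s * k := Nat.mul_le_mul_left s j.isLt
  rw [mul_add, mul_one] at h1 h2
  omega

theorem stableKneserGraph_exists_isHamiltonianCycle {n k s : ℕ} (hk : 1 ≤ k) (hs : 2 ≤ s)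
    (hn : s * k + 1 ≤ n) :
    ∃ A, ∃ p : (stableKneserGraph n k s).Walk A A, p.IsHamiltonianCycle := by
  have h2k : 2 * k + 1 ≤ n := le_trans (Nat.succ_le_succ (Nat.mul_le_mul_right k hs)) hn
  have : NeZero n := ⟨by omega⟩
  have : Nonempty (StableVertex n k s) := nonempty_stableVertex (by omega) (by omega)
  refine SimpleGraph.exists_isHamiltonianCycle_of_perm (StableVertex.rot 1)
    (fun X => StableVertex.adj_of_disjoint hk (StableVertex.disjoint_rot_one hs (by omega) X))
    (StableVertex.rot_one_rot_one_ne hk h2k) StableVertex.Paired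
    (fun _ _ h => h.symm) (fun _ _ _ h h' => h.unique hs (by omega) h') (fun X Y h => ?_)
    (fun U hne h1 h2 => StableVertex.IsClosedSet.eq_univ ⟨h1, h2⟩ hne hk hs (by omega))
  have hd := h.disjoint hs (by omega)
  exact ⟨StableVertex.adj_of_disjoint hk hd,
    StableVertex.adj_of_disjoint hk (StableVertex.disjoint_rot hd 1)⟩

theorem theorem1 :
    (∀ n k s : ℕ, 1 ≤ k → 2 ≤ s → s * k + 1 ≤ n →
      ∃ A, ∃ p : (stableKneserGraph n k s).Walk A A, p.IsHamiltonianCycle) ∧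
    (∀ n k : ℕ, 1 ≤ k → 2 * k + 1 ≤ n →
      ∃ A, ∃ p : (schrijverGraph n k).Walk A A, p.IsHamiltonianCycle) := by
  refine ⟨fun n k s hk hs hn => stableKneserGraph_exists_isHamiltonianCycle hk hs hn,
    fun n k hk hn => ?_⟩
  have h := stableKneserGraph_exists_isHamiltonianCycle hk le_rfl hn
  unfold stableKneserGraph at h
  unfold schrijverGraph
  have hset : {A : {A : Finset (Fin n) // A.card = k} | NoCyclicallyAdjacent A.1} =
      {A | IsStableSet 2 A.1} := Set.ext fun A => noCyclicallyAdjacent_iff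
  rw [hset]
  exact h
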